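/- For real $\alpha_2,\alpha_3>0$ let $Q_{\alpha_2,\alpha_3}(x)=x_1^2+\alpha_2x_2^2-\alpha_3x_3^2$ for $x=(x_1,x_2,x_3)\in\mathbb Z^3$, and let $|x|$ denote the Euclidean norm. For almost every $(\alpha_2,\alpha_3)\in[\tfrac12,1]^2$, with respect to two-dimensional Lebesgue measure, the following holds (unconditionally): for every $\varepsilon>0$ there is a constant $C>0$, depending only on $\varepsilon,\alpha_2,\alpha_3$, such that for every real $N>1$ $$ \min_{\substack{x\in\mathbb Z^3\\ 0<|x|<N}}|Q_{\alpha_2,\alpha_3}(x)|\le C\,N^{-1+\varepsilon}. $$ -/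

import Mathlib

open MeasureTheory Set

/-- The ternary diagonal form `Q(x) = x₁² + α₂ x₂² - α₃ x₃²` at an integer vector. -/
noncomputable def diagForm (α₂ α₃ : ℝ) (x : Fin 3 → ℤ) : ℝ :=
  (x 0 : ℝ) ^ 2 + α₂ * (x 1 : ℝ) ^ 2 - α₃ * (x 2 : ℝ) ^ 2

/-- The Euclidean norm of an integer vector. -/
noncomputable def euclNorm (x : Fin 3 → ℤ) : ℝ :=
  ‖(WithLp.toLp 2 (fun i => (x i : ℝ)) : EuclideanSpace ℝ (Fin 3))‖

/-- The set of all `|Q(x)|` with `x ∈ ℤ³` and `0 < |x| < N`. -/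
def absValues (α₂ α₃ N : ℝ) : Set ℝ :=
  {v | ∃ x : Fin 3 → ℤ, 0 < euclNorm x ∧ euclNorm x < N ∧ v = |diagForm α₂ α₃ x|}

/-!
For fixed `x = (a, b, c)` the form vanishes along the line `α₃ = (a / c)² + (b / c)² α₂` in the
plane of parameters, and `|Q(x)|` is `c²` times the vertical distance to it. For `a, b, c` of size
`M` the claim is that almost every point is, for large dyadic `M`, within `κ = M ^ (-3 + ε)` of one
of these `M³` lines.

Counting the lines within `1 / M` of a point is easy: for every `(b, c)` some `a` works. The count
at scale `κ` is compared with this one by the second moment of the sum, over the lines, of a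
mean-zero kernel, the difference of the uniform densities at the two scales. At a point missed by
all lines at scale `κ` the square of this sum is at least `M ^ 6 / 4`. In the second moment, a pair
of lines whose slopes differ contributes the integral of the autocorrelation of the kernel along a
line of nonzero slope; as the autocorrelation has mean zero, this vanishes unless the lines are
`2 / M`-close at an end point of `[1/2, 1]`. What remains is weighted by `1 / |b c' - c b'|`, and
linear congruences reduce the sum of these weights to an average of `gcd(b, c)`, which costs only
powers of `log M`. So the missed set has measure `O(M ^ (-ε) log² M)`, and Borel–Cantelli applies.
-/

section Autocorrelation

variable {K : ℝ → ℝ} {C w : ℝ}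

/-- The autocorrelation `m ↦ ∫ K(t) K(t - m) dt` of a function on the line: the overlap of two
translates of `K` whose centres are `m` apart. -/
noncomputable def autocorrelation (K : ℝ → ℝ) (m : ℝ) : ℝ := ∫ t, K t * K (t - m)

lemma autocorrelation_eq_convolution (K : ℝ → ℝ) :
    autocorrelation K =
      convolution K (fun t => K (-t)) (ContinuousLinearMap.mul ℝ ℝ) volume := by
  ext m
  simp only [autocorrelation, convolution, ContinuousLinearMap.mul_apply', neg_sub]

lemma integrable_autocorrelation (hK : Integrable K) : Integrable (autocorrelation K) := by
  rw [autocorrelation_eq_convolution]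
  exact hK.integrable_convolution _ hK.comp_neg

lemma integral_autocorrelation (hK : Integrable K) :
    ∫ m, autocorrelation K m = (∫ t, K t) ^ 2 := by
  rw [autocorrelation_eq_convolution, integral_convolution _ hK hK.comp_neg,
    integral_neg_eq_self K volume, ContinuousLinearMap.mul_apply', sq]

lemma integral_abs_autocorrelation_le (hK : Integrable K) :
    ∫ m, |autocorrelation K m| ≤ (∫ t, |K t|) ^ 2 := by
  rw [← integral_autocorrelation hK.abs]
  refine integral_mono (integrable_autocorrelation hK).abs (integrable_autocorrelation hK.abs)
    fun m => abs_integral_le_integral_abs.trans_eq ?_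
  simp only [abs_mul, autocorrelation]

lemma measurable_autocorrelation (hK : Measurable K) : Measurable (autocorrelation K) :=
  have hjoint : Measurable fun p : ℝ × ℝ => K p.2 * K (p.2 - p.1) := by fun_prop
  hjoint.stronglyMeasurable.integral_prod_right'.measurable

lemma abs_autocorrelation_le (hK : Integrable K) (hC : ∀ t, |K t| ≤ C) (m : ℝ) :
    |autocorrelation K m| ≤ C * ∫ t, |K t| := by
  rw [← integral_const_mul C fun t => |K t|]
  refine norm_integral_le_of_norm_le (f := fun t => K t * K (t - m)) (hK.abs.const_mul C)
    (.of_forall fun t => ?_)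
  rw [Real.norm_eq_abs, abs_mul, mul_comm]
  exact mul_le_mul_of_nonneg_right (hC _) (abs_nonneg _)

lemma autocorrelation_eq_zero_of_lt_abs (hw : ∀ t, w < |t| → K t = 0) {m : ℝ}
    (hm : 2 * w < |m|) : autocorrelation K m = 0 := by
  refine integral_eq_zero_of_ae (.of_forall fun t => ?_)
  rcases lt_or_ge w |t| with ht | ht
  · exact mul_eq_zero_of_left (hw t ht) _
  · refine mul_eq_zero_of_right _ (hw _ ?_)
    linarith [abs_sub_abs_le_abs_sub m t, abs_sub_comm m t]

lemma integral_mul_translate (K : ℝ → ℝ) (a b : ℝ) :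
    ∫ s, K (s - a) * K (s - b) = autocorrelation K (b - a) := by
  rw [autocorrelation, ← integral_sub_right_eq_self (fun t => K t * K (t - (b - a))) a]
  simp only [sub_sub, add_sub_cancel]

lemma integrable_mul_translate (hK : Integrable K) (hC : ∀ t, |K t| ≤ C) (a b : ℝ) :
    Integrable fun s => K (s - a) * K (s - b) :=
  (hK.comp_sub_right a).mul_bdd (c := C) (hK.comp_sub_right b).aestronglyMeasurable
    (.of_forall fun _ => hC _)

end Autocorrelation

section SecondMoment

variable {ι T : Type*} [MeasurableSpace T] {K : ℝ → ℝ} {C : ℝ}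

lemma integrable_sq_sum_translate (hK : Integrable K) (hC : ∀ t, |K t| ≤ C) (I : Finset ι)
    (c : ι → ℝ) : Integrable fun s => (∑ i ∈ I, K (s - c i)) ^ 2 := by
  simp_rw [sq, Finset.sum_mul_sum]
  exact integrable_finsetSum _ fun i _ => integrable_finsetSum _ fun j _ =>
    integrable_mul_translate hK hC _ _

lemma integral_sq_sum_translate (hK : Integrable K) (hC : ∀ t, |K t| ≤ C) (I : Finset ι)
    (c : ι → ℝ) :
    ∫ s, (∑ i ∈ I, K (s - c i)) ^ 2 = ∑ i ∈ I, ∑ j ∈ I, autocorrelation K (c j - c i) := by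
  have hint i j := integrable_mul_translate hK hC (c i) (c j)
  simp_rw [sq, Finset.sum_mul_sum, ← integral_mul_translate K]
  rw [integral_finsetSum _ fun i _ => integrable_finsetSum _ fun j _ => hint i j]
  exact Finset.sum_congr rfl fun i _ => integral_finsetSum _ fun j _ => hint i j

lemma integrable_autocorrelation_comp (hK : Integrable K) (hKm : Measurable K)
    (hC : ∀ t, |K t| ≤ C) (μ : Measure T) [IsFiniteMeasure μ] {g : T → ℝ} (hg : Measurable g) :
    Integrable (fun t => autocorrelation K (g t)) μ :=
  .of_bound ((measurable_autocorrelation hKm).comp hg).aestronglyMeasurable _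
    (.of_forall fun _ => abs_autocorrelation_le hK hC _)

lemma lintegral_sq_sum_translate (hK : Integrable K) (hKm : Measurable K)
    (hC : ∀ t, |K t| ≤ C) (μ : Measure T) [IsFiniteMeasure μ] (I : Finset ι) {f : ι → T → ℝ}
    (hf : ∀ i, Measurable (f i)) :
    ∫⁻ t, ∫⁻ s, ENNReal.ofReal ((∑ i ∈ I, K (s - f i t)) ^ 2) ∂volume ∂μ =
      ENNReal.ofReal (∑ i ∈ I, ∑ j ∈ I, ∫ t, autocorrelation K (f j t - f i t) ∂μ) := by
  have hint i j : Integrable (fun t => autocorrelation K (f j t - f i t)) μ :=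
    integrable_autocorrelation_comp hK hKm hC μ ((hf j).sub (hf i))
  have hinner t : ∫⁻ s, ENNReal.ofReal ((∑ i ∈ I, K (s - f i t)) ^ 2) =
      ENNReal.ofReal (∑ i ∈ I, ∑ j ∈ I, autocorrelation K (f j t - f i t)) := by
    rw [← integral_sq_sum_translate hK hC, ofReal_integral_eq_lintegral_ofReal
      (integrable_sq_sum_translate hK hC I _) (.of_forall fun _ => sq_nonneg _)]
  have hnonneg t : 0 ≤ ∑ i ∈ I, ∑ j ∈ I, autocorrelation K (f j t - f i t) := by
    rw [← integral_sq_sum_translate hK hC]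
    exact integral_nonneg fun _ => sq_nonneg _
  simp_rw [hinner]
  rw [← ofReal_integral_eq_lintegral_ofReal
    (integrable_finsetSum _ fun i _ => integrable_finsetSum _ fun j _ => hint i j)
    (.of_forall hnonneg),
    integral_finsetSum _ fun i _ => integrable_finsetSum _ fun j _ => hint i j]
  congr 1
  exact Finset.sum_congr rfl fun i _ => integral_finsetSum _ fun j _ => hint i j

lemma measure_le_of_forall_le_sq_sum_translate (hK : Integrable K) (hKm : Measurable K)
    (hC : ∀ t, |K t| ≤ C) (μ : Measure T) [IsFiniteMeasure μ] (I : Finset ι) {f : ι → T → ℝ}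
    (hf : ∀ i, Measurable (f i)) {S : Set (T × ℝ)} {L : ℝ} (hL : 0 < L)
    (hS : ∀ α ∈ S, L ≤ (∑ i ∈ I, K (α.2 - f i α.1)) ^ 2) :
    (μ.prod volume) S ≤
      ENNReal.ofReal ((∑ i ∈ I, ∑ j ∈ I, ∫ t, autocorrelation K (f j t - f i t) ∂μ) / L) := by
  have hmeas : Measurable fun α : T × ℝ =>
      ENNReal.ofReal ((∑ i ∈ I, K (α.2 - f i α.1)) ^ 2) := by fun_prop
  rw [ENNReal.ofReal_div_of_pos hL, ← lintegral_sq_sum_translate hK hKm hC μ I hf,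
    ← lintegral_prod _ hmeas.aemeasurable]
  refine (measure_mono fun α hα => ENNReal.ofReal_le_ofReal (hS α hα)).trans
    (meas_ge_le_lintegral_div hmeas.aemeasurable ?_ ENNReal.ofReal_ne_top)
  simpa only [ne_eq, ENNReal.ofReal_eq_zero, not_le] using hL

end SecondMoment

section AffineAverage

variable {H : ℝ → ℝ} {S : ℝ}

lemma intervalIntegral_eq_zero_of_lt_abs (h0 : ∫ m, H m = 0) (hS : ∀ m, S < |m| → H m = 0)
    {a b : ℝ} (ha : S < |a|) (hb : S < |b|) : ∫ m in a..b, H m = 0 := by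
  wlog hab : a ≤ b generalizing a b
  · rw [intervalIntegral.integral_symm, this hb ha (le_of_not_ge hab), neg_zero]
  by_cases hcover : a < -S ∧ S < b
  · rw [intervalIntegral.integral_eq_integral_of_support_subset, h0]
    intro m hm
    have hmS : |m| ≤ S := not_lt.mp fun h => hm (hS m h)
    exact ⟨hcover.1.trans_le (abs_le.mp hmS).1, (abs_le.mp hmS).2.trans hcover.2.le⟩
  · rw [intervalIntegral.integral_of_le hab]
    refine setIntegral_eq_zero_of_forall_eq_zero fun m hm => hS m ?_
    rw [lt_abs] at ha hb ⊢
    grind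

/-- Since `H` has mean zero, only an end point of the interval falling into the support of `H`
prevents its integral along a line of nonzero slope from cancelling completely. -/
lemma abs_integral_comp_affine_le (hH : Integrable H) (h0 : ∫ m, H m = 0)
    (hS : ∀ m, S < |m| → H m = 0) {E D a b : ℝ} (hD : D ≠ 0) :
    |∫ t in a..b, H (E + D * t)| ≤ |D|⁻¹ * (∫ m, |H m|) *
      ((if |E + D * a| ≤ S then 1 else 0) + (if |E + D * b| ≤ S then 1 else 0)) := by
  rw [intervalIntegral.integral_comp_add_mul H hD E, smul_eq_mul, abs_mul, abs_inv, mul_assoc]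
  refine mul_le_mul_of_nonneg_left ?_ (by positivity)
  have hnonneg : 0 ≤ ∫ m, |H m| := integral_nonneg fun _ => abs_nonneg _
  have htrivial : |∫ m in E + D * a..E + D * b, H m| ≤ ∫ m, |H m| :=
    (intervalIntegral.norm_integral_le_integral_norm_uIoc (f := H) (μ := volume)).trans
      (setIntegral_le_integral hH.abs (.of_forall fun _ => abs_nonneg _))
  split_ifs with ha hb hb
  · linarith
  · linarith
  · linarith
  · rw [intervalIntegral_eq_zero_of_lt_abs h0 hS (not_le.mp ha) (not_le.mp hb)]
    simp

end AffineAverage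

section Window

variable {v w t : ℝ}

/-- The uniform probability density on `[-w, w]`. -/
noncomputable def uniformDensity (w : ℝ) : ℝ → ℝ := (Icc (-w) w).indicator fun _ => 1 / (2 * w)

lemma uniformDensity_of_abs_le (h : |t| ≤ w) : uniformDensity w t = 1 / (2 * w) :=
  indicator_of_mem (mem_Icc.mpr (abs_le.mp h)) _

lemma uniformDensity_of_lt_abs (h : w < |t|) : uniformDensity w t = 0 :=
  indicator_of_notMem (fun ht => h.not_ge (abs_le.mpr (mem_Icc.mp ht))) _

lemma uniformDensity_nonneg (hw : 0 < w) (t : ℝ) : 0 ≤ uniformDensity w t :=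
  indicator_nonneg (fun _ _ => by positivity) t

lemma uniformDensity_le (hw : 0 < w) (t : ℝ) : uniformDensity w t ≤ 1 / (2 * w) :=
  indicator_le_self' (fun _ _ => by positivity) t

lemma measurable_uniformDensity (w : ℝ) : Measurable (uniformDensity w) :=
  measurable_const.indicator measurableSet_Icc

lemma integrable_uniformDensity (w : ℝ) : Integrable (uniformDensity w) :=
  (integrable_indicator_iff measurableSet_Icc).mpr
    (integrableOn_const measure_Icc_lt_top.ne enorm_ne_top)

lemma integral_uniformDensity (hw : 0 < w) : ∫ t, uniformDensity w t = 1 := by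
  rw [uniformDensity, integral_indicator measurableSet_Icc, setIntegral_const, smul_eq_mul,
    Real.volume_real_Icc_of_le (by linarith)]
  field_simp
  norm_num

/-- The mean-zero kernel comparing counts at the fine scale `v` and at the coarse scale `w`. -/
noncomputable def scaleDifference (v w t : ℝ) : ℝ := uniformDensity v t - uniformDensity w t

lemma measurable_scaleDifference (v w : ℝ) : Measurable (scaleDifference v w) :=
  (measurable_uniformDensity v).sub (measurable_uniformDensity w)

lemma integrable_scaleDifference (v w : ℝ) : Integrable (scaleDifference v w) :=
  (integrable_uniformDensity v).sub (integrable_uniformDensity w)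

lemma integral_scaleDifference (hv : 0 < v) (hw : 0 < w) : ∫ t, scaleDifference v w t = 0 := by
  simp_rw [scaleDifference]
  rw [integral_sub (integrable_uniformDensity v) (integrable_uniformDensity w),
    integral_uniformDensity hv, integral_uniformDensity hw, sub_self]

lemma scaleDifference_of_lt_abs (hvw : v ≤ w) (h : w < |t|) : scaleDifference v w t = 0 := by
  rw [scaleDifference, uniformDensity_of_lt_abs h, uniformDensity_of_lt_abs (hvw.trans_lt h),
    sub_self]

lemma abs_scaleDifference_le (hv : 0 < v) (hvw : v ≤ w) (t : ℝ) :
    |scaleDifference v w t| ≤ 1 / (2 * v) :=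
  abs_sub_le_of_nonneg_of_le (uniformDensity_nonneg hv t) (uniformDensity_le hv t)
    (uniformDensity_nonneg (hv.trans_le hvw) t)
    ((uniformDensity_le (hv.trans_le hvw) t).trans (by gcongr))

lemma integral_abs_scaleDifference_le (hv : 0 < v) (hw : 0 < w) :
    ∫ t, |scaleDifference v w t| ≤ 2 := by
  have hiv := integrable_uniformDensity v
  have hiw := integrable_uniformDensity w
  calc ∫ t, |scaleDifference v w t| ≤ ∫ t, (uniformDensity v t + uniformDensity w t) :=
        integral_mono (integrable_scaleDifference v w).abs (hiv.add hiw) fun t =>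
          (abs_sub _ _).trans_eq (by
            rw [abs_of_nonneg (uniformDensity_nonneg hv t),
              abs_of_nonneg (uniformDensity_nonneg hw t)])
    _ = 2 := by
        rw [integral_add hiv hiw, integral_uniformDensity hv, integral_uniformDensity hw]
        norm_num

lemma integral_autocorrelation_scaleDifference (hv : 0 < v) (hw : 0 < w) :
    ∫ m, autocorrelation (scaleDifference v w) m = 0 := by
  rw [integral_autocorrelation (integrable_scaleDifference v w), integral_scaleDifference hv hw,
    zero_pow two_ne_zero]

lemma integral_abs_autocorrelation_scaleDifference_le (hv : 0 < v) (hw : 0 < w) :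
    ∫ m, |autocorrelation (scaleDifference v w) m| ≤ 4 :=
  calc _ ≤ (∫ t, |scaleDifference v w t|) ^ 2 :=
        integral_abs_autocorrelation_le (integrable_scaleDifference v w)
    _ ≤ 2 ^ 2 := pow_le_pow_left₀ (integral_nonneg fun _ => abs_nonneg _)
        (integral_abs_scaleDifference_le hv hw) 2
    _ = 4 := by norm_num

lemma abs_autocorrelation_scaleDifference_le (hv : 0 < v) (hvw : v ≤ w) (m : ℝ) :
    |autocorrelation (scaleDifference v w) m| ≤ 1 / v :=
  calc _ ≤ 1 / (2 * v) * ∫ t, |scaleDifference v w t| :=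
        abs_autocorrelation_le (integrable_scaleDifference v w) (abs_scaleDifference_le hv hvw) m
    _ ≤ 1 / (2 * v) * 2 := by
        gcongr
        exact integral_abs_scaleDifference_le hv (hv.trans_le hvw)
    _ = 1 / v := by field_simp

end Window

section Arithmetic

lemma card_filter_sq_near_le {s : Finset ℕ} {M : ℕ} (hs : ∀ y ∈ s, M ≤ y) (R : ℕ)
    (X : ℝ) : (s.filter fun y : ℕ => |(y : ℝ) ^ 2 - X| ≤ R * M).card ≤ R + 1 := by
  set u := s.filter fun y : ℕ => |(y : ℝ) ^ 2 - X| ≤ R * M with hu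
  rcases u.eq_empty_or_nonempty with hempty | hne
  · simp [hempty]
  have hsub : u ⊆ Finset.Icc (u.min' hne) (u.min' hne + R) := by
    intro y hy
    have hy₀ := u.min'_mem hne
    refine Finset.mem_Icc.mpr ⟨u.min'_le y hy, ?_⟩
    generalize u.min' hne = y₀ at hy₀ ⊢
    rw [hu, Finset.mem_filter] at hy hy₀
    have hsum : 2 * (M : ℝ) ≤ y + y₀ := mod_cast
      (two_mul M).trans_le (add_le_add (hs y hy.1) (hs y₀ hy₀.1))
    have hdiff : ((y : ℝ) - y₀) * (y + y₀) ≤ R * (2 * M) := by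
      linarith [(abs_le.mp hy.2).2, (abs_le.mp hy₀.2).1]
    by_contra! hlt
    have hlt' : (y₀ : ℝ) + R < y := mod_cast hlt
    have hpos : (0 : ℝ) < y + y₀ := mod_cast (by omega : 0 < y + y₀)
    refine hdiff.not_gt ?_
    calc R * (2 * (M : ℝ)) ≤ R * (y + y₀) := by gcongr
      _ < (y - y₀) * (y + y₀) := by
        gcongr
        linarith
  refine (Finset.card_le_card hsub).trans_eq ?_
  rw [Nat.card_Icc]
  omega

lemma gcd_le_sum_dvd {m a : ℕ} (ha : a ∈ Finset.Ioc 0 m) (b : ℕ) :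
    (Nat.gcd a b : ℝ) ≤
      ∑ g ∈ Finset.Ioc 0 m, (g : ℝ) * ((if g ∣ a then 1 else 0) * (if g ∣ b then 1 else 0)) := by
  rw [Finset.mem_Ioc] at ha
  have hmem : Nat.gcd a b ∈ Finset.Ioc 0 m := Finset.mem_Ioc.mpr
    ⟨Nat.gcd_pos_of_pos_left _ ha.1, (Nat.gcd_le_left _ ha.1).trans ha.2⟩
  refine le_trans (le_of_eq ?_)
    (Finset.single_le_sum (f := fun g : ℕ => (g : ℝ) * (_ * _)) (fun g _ => by positivity) hmem)
  simp only [Nat.gcd_dvd_left, Nat.gcd_dvd_right, if_true, mul_one]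

lemma sum_gcd_le (m n : ℕ) :
    ∑ a ∈ Finset.Ioc 0 m, ∑ b ∈ Finset.Ioc 0 n, (Nat.gcd a b : ℝ) ≤ m * n * harmonic m := by
  have hcount (l g : ℕ) :
      ∑ a ∈ Finset.Ioc 0 l, (if g ∣ a then (1 : ℝ) else 0) = ((l / g : ℕ) : ℝ) := by
    rw [Finset.sum_boole, Nat.Ioc_filter_dvd_card_eq_div]
  calc ∑ a ∈ Finset.Ioc 0 m, ∑ b ∈ Finset.Ioc 0 n, (Nat.gcd a b : ℝ)
      ≤ ∑ a ∈ Finset.Ioc 0 m, ∑ b ∈ Finset.Ioc 0 n, ∑ g ∈ Finset.Ioc 0 m,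
          (g : ℝ) * ((if g ∣ a then 1 else 0) * (if g ∣ b then 1 else 0)) :=
        Finset.sum_le_sum fun a ha => Finset.sum_le_sum fun b _ => gcd_le_sum_dvd ha b
    _ = ∑ g ∈ Finset.Ioc 0 m, (g : ℝ) * (((m / g : ℕ) : ℝ) * ((n / g : ℕ) : ℝ)) := by
        simp_rw [Finset.sum_comm (s := Finset.Ioc 0 n)]
        rw [Finset.sum_comm]
        simp_rw [← Finset.mul_sum, ← Finset.sum_mul, hcount]
    _ ≤ ∑ g ∈ Finset.Ioc 0 m, (m : ℝ) * n * (g : ℝ)⁻¹ := by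
        refine Finset.sum_le_sum fun g hg => ?_
        have hg0 : (0 : ℝ) < g := mod_cast (Finset.mem_Ioc.mp hg).1
        calc (g : ℝ) * (((m / g : ℕ) : ℝ) * ((n / g : ℕ) : ℝ)) ≤ g * ((m / g) * (n / g)) := by
              gcongr <;> exact Nat.cast_div_le
          _ = m * n * (g : ℝ)⁻¹ := by field_simp
    _ = m * n * harmonic m := by
        rw [← Finset.mul_sum, harmonic_eq_sum_Icc]
        push_cast
        rfl

/-- The second coordinate of a solution of `b y - c x = d` is determined modulo `c / gcd b c`. -/
lemma card_filter_mul_sub_mul_eq_le {b c L : ℕ} (hc : 0 < c) (hL : L ≤ c) (s : Finset ℕ) (m : ℕ)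
    (d : ℤ) :
    ((s ×ˢ Finset.Ico m (m + L)).filter fun q : ℕ × ℕ => (b : ℤ) * q.2 - c * q.1 = d).card ≤
      Nat.gcd b c := by
  set g := Nat.gcd b c with hg
  have hcg : c / g * g = c := Nat.div_mul_cancel (Nat.gcd_dvd_right b c)
  rw [← Finset.card_range g]
  refine Finset.card_le_card_of_injOn (fun q => (q.2 - m) / (c / g)) (fun q hq => ?_)
    fun q hq q' hq' hqq' => ?_
  · simp only [Finset.coe_filter, Finset.mem_product, Finset.mem_Ico, Set.mem_ofPred_eq] at hq
    rw [Finset.coe_range, Set.mem_Iio]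
    exact Nat.div_lt_of_lt_mul (by omega)
  · simp only [Finset.coe_filter, Finset.mem_product, Finset.mem_Ico, Set.mem_ofPred_eq] at hq hq'
    have hmod : q.2 - m ≡ q'.2 - m [MOD c / g] := by
      have hbq : b * q.2 ≡ b * q'.2 [MOD c] := by
        rw [Nat.modEq_iff_dvd]
        exact ⟨(q'.1 : ℤ) - q.1, by push_cast; linarith [hq.2, hq'.2]⟩
      have hq2 := Nat.ModEq.cancel_left_div_gcd hc hbq
      rw [Nat.gcd_comm, ← hg] at hq2
      refine Nat.ModEq.add_left_cancel' m ?_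
      rwa [Nat.add_sub_of_le hq.1.2.1, Nat.add_sub_of_le hq'.1.2.1]
    have hsnd : q.2 = q'.2 := by
      have hsub : q.2 - m = q'.2 - m := by
        have hdiv : (q.2 - m) / (c / g) = (q'.2 - m) / (c / g) := hqq'
        rw [← Nat.div_add_mod (q.2 - m) (c / g), hdiv, hmod, Nat.div_add_mod]
      omega
    have hfst : (c : ℤ) * q.1 = c * q'.1 := by
      rw [hsnd] at hq
      linarith [hq.2, hq'.2]
    exact Prod.ext (Nat.eq_of_mul_eq_mul_left hc (mod_cast hfst)) hsnd

lemma sum_Icc_inv_max_one_abs (n : ℕ) :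
    ∑ d ∈ Finset.Icc (-n : ℤ) n, (max 1 |(d : ℝ)|)⁻¹ = 1 + 2 * harmonic n := by
  have heven : (fun d : ℤ => (max 1 |(d : ℝ)|)⁻¹).Even := fun d => by
    simp only [Int.cast_neg, abs_neg]
  rw [Finset.sum_Icc_of_even_eq_range heven, Finset.sum_range_succ', harmonic]
  have hterm (k : ℕ) : (max 1 |(((k + 1 : ℕ) : ℤ) : ℝ)|)⁻¹ = ((k : ℝ) + 1)⁻¹ := by
    rw [max_eq_right] <;> push_cast <;> rw [abs_of_nonneg (by positivity)]
    linarith [(Nat.cast_nonneg k : (0 : ℝ) ≤ k)]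
  simp only [hterm]
  push_cast
  norm_num
  ring

lemma harmonic_nonneg (n : ℕ) : (0 : ℝ) ≤ harmonic n := by
  rw [harmonic]
  push_cast
  positivity

lemma harmonic_le_of_le_two_pow {n k : ℕ} (h : n ≤ 2 ^ k) : (harmonic n : ℝ) ≤ k + 1 := by
  rcases n.eq_zero_or_pos with rfl | hn
  · simp only [harmonic_zero, Rat.cast_zero]
    positivity
  have hlog : Real.log n ≤ k :=
    calc Real.log n ≤ Real.log (2 ^ k) :=
          Real.log_le_log (mod_cast hn) (mod_cast h)
      _ = k * Real.log 2 := Real.log_pow _ _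
      _ ≤ k * 1 := by gcongr; linarith [Real.log_two_lt_d9]
      _ = k := mul_one _
  linarith [harmonic_le_one_add_log n]

end Arithmetic

section Lines

variable {M : ℕ} {κ w : ℝ} {p q : ℕ × ℕ} {x y : ℕ × ℕ × ℕ}

/-- The pairs `(b, c)` of second and third coordinates that are used at scale `M`. The ranges make
`α₃ c² - α₂ b²` comparable with `M²` for `α₂, α₃ ∈ [1/2, 1]`. -/
def pairBox (M : ℕ) : Finset (ℕ × ℕ) := Finset.Ico M (2 * M) ×ˢ Finset.Ico (4 * M) (5 * M)

/-- The integer vectors `(a, b, c)` that are used at scale `M`. -/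
def tripleBox (M : ℕ) : Finset (ℕ × ℕ × ℕ) := Finset.Icc M (5 * M) ×ˢ pairBox M

/-- The slope `(b / c)²` of the line of parameters at which the form vanishes at `(a, b, c)`. -/
noncomputable def zeroSlope (p : ℕ × ℕ) : ℝ := ((p.1 : ℝ) / p.2) ^ 2

/-- The line `α₃ = (a / c)² + (b / c)² α₂` of parameters at which the form vanishes at
`x = (a, b, c)`, as a function of `α₂ = t`. -/
noncomputable def zeroLine (x : ℕ × ℕ × ℕ) (t : ℝ) : ℝ :=
  ((x.1 : ℝ) / x.2.2) ^ 2 + zeroSlope x.2 * t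

/-- The determinant of the pairs `p` and `q`, which vanishes when their zero lines are parallel. -/
def pairDet (p q : ℕ × ℕ) : ℤ := p.1 * q.2 - p.2 * q.1

/-- The weight `1 / |det(p, q)|` of a couple of pairs, or `1` if the determinant vanishes. -/
noncomputable def detWeight (p q : ℕ × ℕ) : ℝ := (max 1 |(pairDet p q : ℝ)|)⁻¹

/-- The indicator that the zero lines of `x` and `y` are within `2 w` of each other at `t`, so that
windows of half-width `w` around them can overlap. -/
noncomputable def closeAt (w : ℝ) (x y : ℕ × ℕ × ℕ) (t : ℝ) : ℝ :=
  if |zeroLine y t - zeroLine x t| ≤ 2 * w then 1 else 0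

lemma detWeight_nonneg (p q : ℕ × ℕ) : 0 ≤ detWeight p q := by
  unfold detWeight
  positivity

lemma closeAt_nonneg (w : ℝ) (x y : ℕ × ℕ × ℕ) (t : ℝ) : 0 ≤ closeAt w x y t := by
  unfold closeAt
  positivity

lemma measurable_zeroLine (x : ℕ × ℕ × ℕ) : Measurable (zeroLine x) := by
  unfold zeroLine
  fun_prop

lemma zeroLine_sub_zeroLine (x y : ℕ × ℕ × ℕ) (t : ℝ) :
    zeroLine y t - zeroLine x t =
      ((y.1 : ℝ) / y.2.2) ^ 2 - ((x.1 : ℝ) / x.2.2) ^ 2 +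
        (zeroSlope y.2 - zeroSlope x.2) * t := by
  unfold zeroLine
  ring

lemma pos_of_mem_pairBox (hp : p ∈ pairBox M) : (0 : ℝ) < M := by
  rw [pairBox, Finset.mem_product, Finset.mem_Ico] at hp
  exact mod_cast (by omega : 0 < M)

lemma fst_bounds_of_mem_pairBox (hp : p ∈ pairBox M) : (M : ℝ) ≤ p.1 ∧ (p.1 : ℝ) ≤ 2 * M := by
  rw [pairBox, Finset.mem_product, Finset.mem_Ico] at hp
  exact ⟨mod_cast hp.1.1, mod_cast hp.1.2.le⟩

lemma snd_bounds_of_mem_pairBox (hp : p ∈ pairBox M) :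
    4 * (M : ℝ) ≤ p.2 ∧ (p.2 : ℝ) ≤ 5 * M := by
  rw [pairBox, Finset.mem_product, Finset.mem_Ico, Finset.mem_Ico] at hp
  exact ⟨mod_cast hp.2.1, mod_cast hp.2.2.le⟩

lemma zeroSlope_sub_zeroSlope (hp : p ∈ pairBox M) (hq : q ∈ pairBox M) :
    zeroSlope q - zeroSlope p =
      -(pairDet p q * ((q.1 * p.2 + p.1 * q.2) / ((p.2 : ℝ) ^ 2 * (q.2 : ℝ) ^ 2))) := by
  have hM := pos_of_mem_pairBox hp
  have hp2 : (0 : ℝ) < p.2 := by linarith [snd_bounds_of_mem_pairBox hp]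
  have hq2 : (0 : ℝ) < q.2 := by linarith [snd_bounds_of_mem_pairBox hq]
  unfold zeroSlope pairDet
  push_cast
  field_simp
  ring

lemma abs_pairDet_le_abs_zeroSlope_sub (hp : p ∈ pairBox M) (hq : q ∈ pairBox M) :
    8 * |(pairDet p q : ℝ)| ≤ 625 * (M : ℝ) ^ 2 * |zeroSlope q - zeroSlope p| := by
  have hM := pos_of_mem_pairBox hp
  obtain ⟨hp1, -⟩ := fst_bounds_of_mem_pairBox hp
  obtain ⟨hq1, -⟩ := fst_bounds_of_mem_pairBox hq
  obtain ⟨hp2, hp2'⟩ := snd_bounds_of_mem_pairBox hp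
  obtain ⟨hq2, hq2'⟩ := snd_bounds_of_mem_pairBox hq
  have hp2pos : (0 : ℝ) < p.2 := by linarith
  have hq2pos : (0 : ℝ) < q.2 := by linarith
  have hratio : 8 ≤ 625 * (M : ℝ) ^ 2 *
      ((q.1 * p.2 + p.1 * q.2) / ((p.2 : ℝ) ^ 2 * (q.2 : ℝ) ^ 2)) := by
    rw [mul_div_assoc', le_div_iff₀ (by positivity)]
    calc 8 * ((p.2 : ℝ) ^ 2 * (q.2 : ℝ) ^ 2) ≤ 8 * ((5 * M) ^ 2 * (5 * M) ^ 2) := by gcongr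
      _ = 625 * (M : ℝ) ^ 2 * (M * (4 * M) + M * (4 * M)) := by ring
      _ ≤ _ := by gcongr
  rw [zeroSlope_sub_zeroSlope hp hq, abs_neg, abs_mul,
    abs_of_nonneg (a := (_ : ℝ) / _) (by positivity)]
  nlinarith [mul_le_mul_of_nonneg_right hratio (abs_nonneg (pairDet p q : ℝ))]

lemma abs_autocorrelation_zeroLine_sub_le (hκ : 0 < κ) (hκw : κ ≤ w) (x y : ℕ × ℕ × ℕ) (t : ℝ) :
    |autocorrelation (scaleDifference κ w) (zeroLine y t - zeroLine x t)| ≤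
      1 / κ * closeAt w x y t := by
  rw [closeAt]
  split_ifs with h
  · rw [mul_one]
    exact abs_autocorrelation_scaleDifference_le hκ hκw _
  · rw [autocorrelation_eq_zero_of_lt_abs (fun _ => scaleDifference_of_lt_abs hκw) (not_le.mp h)]
    simp

lemma abs_integral_le_closeAt_of_zeroSlope_eq (hκ : 0 < κ) (hκw : κ ≤ w)
    (h : zeroSlope x.2 = zeroSlope y.2) :
    |∫ t in (1 / 2 : ℝ)..1,
        autocorrelation (scaleDifference κ w) (zeroLine y t - zeroLine x t)| ≤
      1 / κ * closeAt w x y 1 := by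
  have hconst (t : ℝ) : zeroLine y t - zeroLine x t = zeroLine y 1 - zeroLine x 1 := by
    simp only [zeroLine_sub_zeroLine, h, sub_self, zero_mul]
  simp_rw [hconst]
  rw [intervalIntegral.integral_const, smul_eq_mul, abs_mul]
  refine (mul_le_of_le_one_left (abs_nonneg _) ?_).trans
    (abs_autocorrelation_zeroLine_sub_le hκ hκw x y 1)
  norm_num [abs_le]

lemma abs_integral_le_closeAt_of_zeroSlope_ne (hκ : 0 < κ) (hκw : κ ≤ w)
    (h : zeroSlope x.2 ≠ zeroSlope y.2) :
    |∫ t in (1 / 2 : ℝ)..1,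
        autocorrelation (scaleDifference κ w) (zeroLine y t - zeroLine x t)| ≤
      |zeroSlope y.2 - zeroSlope x.2|⁻¹ * 4 * (closeAt w x y (1 / 2) + closeAt w x y 1) := by
  have hw := hκ.trans_le hκw
  have hclose (t : ℝ) := closeAt_nonneg w x y t
  have haffine := abs_integral_comp_affine_le
    (integrable_autocorrelation (integrable_scaleDifference κ w))
    (integral_autocorrelation_scaleDifference hκ hw)
    (fun _ => autocorrelation_eq_zero_of_lt_abs fun _ => scaleDifference_of_lt_abs hκw)
    (E := ((y.1 : ℝ) / y.2.2) ^ 2 - ((x.1 : ℝ) / x.2.2) ^ 2) (a := 1 / 2) (b := 1)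
    (sub_ne_zero.mpr h.symm)
  simp only [← zeroLine_sub_zeroLine] at haffine
  refine haffine.trans (mul_le_mul_of_nonneg_right ?_ (add_nonneg (hclose _) (hclose _)))
  gcongr
  exact integral_abs_autocorrelation_scaleDifference_le hκ hw

lemma abs_integral_le_detWeight_mul_closeAt (hκ : 0 < κ) (hκw : κ ≤ w)
    (hκM : (M : ℝ) ^ 2 * κ ≤ 1) (hx : x.2 ∈ pairBox M) (hy : y.2 ∈ pairBox M) :
    |∫ t in (1 / 2 : ℝ)..1,
        autocorrelation (scaleDifference κ w) (zeroLine y t - zeroLine x t)| ≤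
      320 / κ * detWeight x.2 y.2 * (closeAt w x y (1 / 2) + closeAt w x y 1) := by
  have hhalf := closeAt_nonneg w x y (1 / 2)
  have hone := closeAt_nonneg w x y 1
  have hslope := abs_pairDet_le_abs_zeroSlope_sub hx hy
  have hκ' : 0 < 1 / κ := by positivity
  rw [show 320 / κ = 320 * (1 / κ) by ring]
  by_cases hdet : pairDet x.2 y.2 = 0
  · have heq : zeroSlope x.2 = zeroSlope y.2 := by
      rw [eq_comm, ← sub_eq_zero, zeroSlope_sub_zeroSlope hx hy, hdet, Int.cast_zero, zero_mul,
        neg_zero]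
    refine (abs_integral_le_closeAt_of_zeroSlope_eq hκ hκw heq).trans ?_
    rw [detWeight, hdet, Int.cast_zero, abs_zero, max_eq_left zero_le_one, inv_one, mul_one]
    gcongr <;> linarith
  · have hdet1 : (1 : ℝ) ≤ |(pairDet x.2 y.2 : ℝ)| := mod_cast Int.one_le_abs hdet
    have hne : zeroSlope x.2 ≠ zeroSlope y.2 := fun heq => by
      rw [heq, sub_self, abs_zero, mul_zero] at hslope
      linarith
    have hslope0 : 0 < |zeroSlope y.2 - zeroSlope x.2| := abs_pos.mpr (sub_ne_zero.mpr hne.symm)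
    refine (abs_integral_le_closeAt_of_zeroSlope_ne hκ hκw hne).trans
      (mul_le_mul_of_nonneg_right ?_ (add_nonneg hhalf hone))
    have hMκ : (M : ℝ) ^ 2 ≤ 1 / κ := by rwa [le_div_iff₀ hκ]
    rw [detWeight, max_eq_right hdet1, inv_mul_eq_div, ← div_eq_mul_inv,
      div_le_div_iff₀ hslope0 (by linarith)]
    nlinarith [mul_le_mul_of_nonneg_right hMκ hslope0.le]

/-- A zero line with prescribed `(b, c)` is determined by `a²`, and distinct `a ≥ M` have squares
at least `2 M` apart. -/
lemma sum_closeAt_le (x : ℕ × ℕ × ℕ) (hq : q ∈ pairBox M) (t : ℝ) :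
    ∑ a ∈ Finset.Icc M (5 * M), closeAt (1 / M) x (a, q) t ≤ 51 := by
  have hM := pos_of_mem_pairBox hq
  obtain ⟨hq2, hq2'⟩ := snd_bounds_of_mem_pairBox hq
  have hq2pos : (0 : ℝ) < q.2 := by linarith
  set X := (q.2 : ℝ) ^ 2 * (zeroLine x t - zeroSlope q * t) with hX
  have hnear (a : ℕ) (ha : |zeroLine (a, q) t - zeroLine x t| ≤ 2 * (1 / M)) :
      |(a : ℝ) ^ 2 - X| ≤ (50 : ℕ) * M := by
    have hscale : (a : ℝ) ^ 2 - X = (q.2 : ℝ) ^ 2 * (zeroLine (a, q) t - zeroLine x t) := by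
      have hline : zeroLine (a, q) t = ((a : ℝ) / q.2) ^ 2 + zeroSlope q * t := rfl
      rw [hX, hline]
      field_simp
      ring
    rw [hscale, abs_mul, abs_of_nonneg (sq_nonneg _)]
    calc _ ≤ (5 * (M : ℝ)) ^ 2 * (2 * (1 / M)) := by gcongr
      _ = (50 : ℕ) * M := by
        field_simp
        norm_num
  have hcard := (Finset.card_le_card (Finset.monotone_filter_right (Finset.Icc M (5 * M))
    fun a _ => hnear a)).trans (card_filter_sq_near_le
      (fun a ha => (Finset.mem_Icc.mp ha).1) 50 X)
  unfold closeAt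
  rw [Finset.sum_boole]
  exact mod_cast hcard

lemma sum_abs_integral_le_sum_detWeight (hκ : 0 < κ) (hκM : (M : ℝ) ^ 2 * κ ≤ 1)
    (hx : x.2 ∈ pairBox M) :
    ∑ y ∈ tripleBox M, |∫ t in (1 / 2 : ℝ)..1,
        autocorrelation (scaleDifference κ (1 / M)) (zeroLine y t - zeroLine x t)| ≤
      320 / κ * 102 * ∑ q ∈ pairBox M, detWeight x.2 q := by
  have hκw : κ ≤ 1 / M := by
    have hM1 : (1 : ℝ) ≤ M := mod_cast pos_of_mem_pairBox hx
    rw [le_div_iff₀ (by linarith)]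
    nlinarith
  rw [tripleBox, Finset.sum_product_right, Finset.mul_sum]
  refine Finset.sum_le_sum fun q hq => ?_
  calc _ ≤ ∑ a ∈ Finset.Icc M (5 * M), 320 / κ * detWeight x.2 q *
        (closeAt (1 / M) x (a, q) (1 / 2) + closeAt (1 / M) x (a, q) 1) :=
        Finset.sum_le_sum fun a _ =>
          abs_integral_le_detWeight_mul_closeAt (y := (a, q)) hκ hκw hκM hx hq
    _ ≤ 320 / κ * detWeight x.2 q * (51 + 51) := by
        rw [← Finset.mul_sum, Finset.sum_add_distrib]
        have hweight := detWeight_nonneg x.2 q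
        gcongr <;> exact sum_closeAt_le x hq _
    _ = 320 / κ * 102 * detWeight x.2 q := by ring

lemma sum_sum_abs_integral_le_sum_detWeight (hκ : 0 < κ) (hκM : (M : ℝ) ^ 2 * κ ≤ 1) :
    ∑ x ∈ tripleBox M, ∑ y ∈ tripleBox M, |∫ t in (1 / 2 : ℝ)..1,
        autocorrelation (scaleDifference κ (1 / M)) (zeroLine y t - zeroLine x t)| ≤
      163200 * M / κ * ∑ p ∈ pairBox M, ∑ q ∈ pairBox M, detWeight p q := by
  have hrow (p : ℕ × ℕ) (hp : p ∈ pairBox M) :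
      ∑ a ∈ Finset.Icc M (5 * M), ∑ y ∈ tripleBox M, |∫ t in (1 / 2 : ℝ)..1,
        autocorrelation (scaleDifference κ (1 / M)) (zeroLine y t - zeroLine (a, p) t)| ≤
      163200 * M / κ * ∑ q ∈ pairBox M, detWeight p q := by
    have hM : 0 < M := mod_cast pos_of_mem_pairBox hp
    have hcard : ((Finset.Icc M (5 * M)).card : ℝ) ≤ 5 * M := by
      rw [Nat.card_Icc]
      exact mod_cast (by omega : 5 * M + 1 - M ≤ 5 * M)
    have hweight : 0 ≤ ∑ q ∈ pairBox M, detWeight p q :=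
      Finset.sum_nonneg fun _ _ => detWeight_nonneg _ _
    calc _ ≤ (Finset.Icc M (5 * M)).card • (320 / κ * 102 * ∑ q ∈ pairBox M, detWeight p q) :=
          Finset.sum_le_card_nsmul _ _ _ fun a _ =>
            sum_abs_integral_le_sum_detWeight (x := (a, p)) hκ hκM hp
      _ ≤ 5 * M * (320 / κ * 102 * ∑ q ∈ pairBox M, detWeight p q) := by
          rw [nsmul_eq_mul]
          gcongr
      _ = 163200 * M / κ * ∑ q ∈ pairBox M, detWeight p q := by ring
  rw [tripleBox, Finset.sum_product_right, Finset.mul_sum]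
  exact Finset.sum_le_sum hrow

lemma pairDet_mem_Icc (hp : p ∈ pairBox M) (hq : q ∈ pairBox M) :
    pairDet p q ∈ Finset.Icc (-(10 * M ^ 2 : ℕ) : ℤ) (10 * M ^ 2 : ℕ) := by
  rw [pairBox, Finset.mem_product, Finset.mem_Ico, Finset.mem_Ico] at hp hq
  have hle : p.1 * q.2 ≤ 10 * M ^ 2 :=
    (Nat.mul_le_mul hp.1.2.le hq.2.2.le).trans_eq (by ring)
  have hle' : p.2 * q.1 ≤ 10 * M ^ 2 :=
    (Nat.mul_le_mul hp.2.2.le hq.1.2.le).trans_eq (by ring)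
  rw [pairDet, Finset.mem_Icc]
  constructor <;> push_cast <;> zify at hle hle' <;> nlinarith

lemma sum_detWeight_le_gcd_mul (hp : p ∈ pairBox M) :
    ∑ q ∈ pairBox M, detWeight p q ≤
      Nat.gcd p.1 p.2 * (1 + 2 * harmonic (10 * M ^ 2)) := by
  have hfiber (d : ℤ) : ((pairBox M).filter fun q => pairDet p q = d).card ≤
      Nat.gcd p.1 p.2 := by
    have hp2 := Finset.mem_Ico.mp (Finset.mem_product.mp hp).2
    have hM : 0 < M := mod_cast pos_of_mem_pairBox hp
    have hcongr := card_filter_mul_sub_mul_eq_le (b := p.1) (c := p.2) (L := M) (by omega)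
      (by omega) (Finset.Ico M (2 * M)) (4 * M) d
    rwa [show 4 * M + M = 5 * M by ring] at hcongr
  rw [← Finset.sum_fiberwise_of_maps_to fun q hq => pairDet_mem_Icc hp hq,
    ← sum_Icc_inv_max_one_abs, Finset.mul_sum]
  refine Finset.sum_le_sum fun d _ => ?_
  calc ∑ q ∈ pairBox M with pairDet p q = d, detWeight p q
      = ∑ q ∈ pairBox M with pairDet p q = d, (max 1 |(d : ℝ)|)⁻¹ :=
        Finset.sum_congr rfl fun q hq => by rw [detWeight, (Finset.mem_filter.mp hq).2]
    _ ≤ Nat.gcd p.1 p.2 * (max 1 |(d : ℝ)|)⁻¹ := by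
        rw [Finset.sum_const, nsmul_eq_mul]
        gcongr
        exact hfiber d

lemma sum_detWeight_le (M : ℕ) :
    ∑ p ∈ pairBox M, ∑ q ∈ pairBox M, detWeight p q ≤
      10 * (M : ℝ) ^ 2 * harmonic (2 * M) * (1 + 2 * harmonic (10 * M ^ 2)) := by
  have hsub : pairBox M ⊆ Finset.Ioc 0 (2 * M) ×ˢ Finset.Ioc 0 (5 * M) := fun p hp => by
    simp only [pairBox, Finset.mem_product, Finset.mem_Ico, Finset.mem_Ioc] at hp ⊢
    omega
  have hgcd : ∑ p ∈ pairBox M, (Nat.gcd p.1 p.2 : ℝ) ≤ 10 * (M : ℝ) ^ 2 * harmonic (2 * M) :=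
    calc _ ≤ ∑ p ∈ Finset.Ioc 0 (2 * M) ×ˢ Finset.Ioc 0 (5 * M), (Nat.gcd p.1 p.2 : ℝ) :=
          Finset.sum_le_sum_of_subset_of_nonneg hsub fun _ _ _ => Nat.cast_nonneg _
      _ ≤ (2 * M : ℕ) * (5 * M : ℕ) * harmonic (2 * M) := by
          rw [Finset.sum_product]
          exact sum_gcd_le _ _
      _ = 10 * (M : ℝ) ^ 2 * harmonic (2 * M) := by
          push_cast
          ring
  have hharmonic := harmonic_nonneg (10 * M ^ 2)
  calc _ ≤ ∑ p ∈ pairBox M, Nat.gcd p.1 p.2 * (1 + 2 * (harmonic (10 * M ^ 2) : ℝ)) :=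
        Finset.sum_le_sum fun p hp => sum_detWeight_le_gcd_mul hp
    _ ≤ _ := by
        rw [← Finset.sum_mul]
        gcongr

end Lines

section CoarseCount

variable {M : ℕ} {t s : ℝ}

lemma exists_sq_le_lt_succ_sq {T : ℝ} (hT : 0 ≤ T) :
    ∃ a : ℕ, (a : ℝ) ^ 2 ≤ T ∧ T < ((a : ℝ) + 1) ^ 2 := by
  refine ⟨Nat.sqrt ⌊T⌋₊, le_trans ?_ (Nat.floor_le hT), (Nat.lt_floor_add_one T).trans_le ?_⟩
  · exact mod_cast Nat.sqrt_le' ⌊T⌋₊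
  · exact mod_cast Nat.succ_le_of_lt (Nat.lt_succ_sqrt' ⌊T⌋₊)

lemma sub_mem_Icc_of_mem_pairBox {p : ℕ × ℕ} (hp : p ∈ pairBox M) (ht : t ∈ Icc (1 / 2 : ℝ) 1)
    (hs : s ∈ Icc (1 / 2 : ℝ) 1) :
    s * (p.2 : ℝ) ^ 2 - t * (p.1 : ℝ) ^ 2 ∈ Icc (4 * (M : ℝ) ^ 2) (25 * (M : ℝ) ^ 2) := by
  obtain ⟨-, hb⟩ := fst_bounds_of_mem_pairBox hp
  obtain ⟨hc, hc'⟩ := snd_bounds_of_mem_pairBox hp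
  have ht0 : 0 ≤ t := by linarith [ht.1]
  have hs0 : 0 ≤ s := by linarith [hs.1]
  have hlower : 1 / 2 * (4 * (M : ℝ)) ^ 2 ≤ s * (p.2 : ℝ) ^ 2 := by
    gcongr
    exact hs.1
  have hupper : s * (p.2 : ℝ) ^ 2 ≤ 1 * (5 * (M : ℝ)) ^ 2 := by
    gcongr
    exact hs.2
  have htb : t * (p.1 : ℝ) ^ 2 ≤ 1 * (2 * (M : ℝ)) ^ 2 := by
    gcongr
    exact ht.2
  have htb' : 0 ≤ t * (p.1 : ℝ) ^ 2 := by positivity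
  constructor <;> linarith

lemma exists_abs_sub_zeroLine_le {p : ℕ × ℕ} (hp : p ∈ pairBox M) (ht : t ∈ Icc (1 / 2 : ℝ) 1)
    (hs : s ∈ Icc (1 / 2 : ℝ) 1) :
    ∃ a ∈ Finset.Icc M (5 * M), |s - zeroLine (a, p) t| ≤ 1 / M := by
  have hM := pos_of_mem_pairBox hp
  have hM1 : (1 : ℝ) ≤ M := mod_cast hM
  obtain ⟨hc, -⟩ := snd_bounds_of_mem_pairBox hp
  have hc0 : (0 : ℝ) < p.2 := by linarith
  obtain ⟨hT, hT'⟩ := sub_mem_Icc_of_mem_pairBox hp ht hs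
  set T := s * (p.2 : ℝ) ^ 2 - t * (p.1 : ℝ) ^ 2 with hTdef
  obtain ⟨a, haT, hTa⟩ := exists_sq_le_lt_succ_sq ((by positivity : (0 : ℝ) ≤ _).trans hT)
  have ha : (M : ℝ) ≤ a := by nlinarith
  have ha' : (a : ℝ) ≤ 5 * M := by nlinarith
  refine ⟨a, Finset.mem_Icc.mpr ⟨mod_cast ha, mod_cast ha'⟩, ?_⟩
  have hdiff : s - zeroLine (a, p) t = (T - (a : ℝ) ^ 2) / (p.2 : ℝ) ^ 2 := by
    simp only [zeroLine, zeroSlope, hTdef]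
    field_simp
    ring
  rw [hdiff, abs_of_nonneg (div_nonneg (by linarith) (by positivity)),
    div_le_div_iff₀ (by positivity) hM]
  nlinarith

lemma le_sum_uniformDensity_zeroLine (M : ℕ) (ht : t ∈ Icc (1 / 2 : ℝ) 1)
    (hs : s ∈ Icc (1 / 2 : ℝ) 1) :
    (M : ℝ) ^ 3 / 2 ≤ ∑ x ∈ tripleBox M, uniformDensity (1 / M) (s - zeroLine x t) := by
  have hfiber (p : ℕ × ℕ) (hp : p ∈ pairBox M) : (M : ℝ) / 2 ≤
      ∑ a ∈ Finset.Icc M (5 * M), uniformDensity (1 / M) (s - zeroLine (a, p) t) := by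
    have hM := pos_of_mem_pairBox hp
    obtain ⟨a, ha, hle⟩ := exists_abs_sub_zeroLine_le hp ht hs
    calc (M : ℝ) / 2 = uniformDensity (1 / M) (s - zeroLine (a, p) t) := by
          rw [uniformDensity_of_abs_le hle]
          field_simp
      _ ≤ _ := Finset.single_le_sum
          (f := fun a => uniformDensity (1 / M) (s - zeroLine (a, p) t))
          (fun _ _ => uniformDensity_nonneg (by positivity) _) ha
  have hcard : (pairBox M).card = M * M := by
    rw [pairBox, Finset.card_product, Nat.card_Ico, Nat.card_Ico]
    congr 1 <;> omega
  calc (M : ℝ) ^ 3 / 2 = (pairBox M).card • ((M : ℝ) / 2) := by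
        rw [hcard, nsmul_eq_mul]
        push_cast
        ring
    _ ≤ _ := Finset.card_nsmul_le_sum _ _ _ hfiber
    _ = _ := by rw [tripleBox, Finset.sum_product_right]

end CoarseCount

section BadSet

variable {M : ℕ} {κ ε : ℝ} {α : ℝ × ℝ}

/-- The parameters `(α₂, α₃)` in the square to which no zero line of the box comes vertically
within `κ`. -/
def badSet (M : ℕ) (κ : ℝ) : Set (ℝ × ℝ) :=
  {α ∈ Icc (1 / 2 : ℝ) 1 ×ˢ Icc (1 / 2 : ℝ) 1 | ∀ x ∈ tripleBox M, κ < |α.2 - zeroLine x α.1|}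

lemma le_sq_sum_scaleDifference_of_mem_badSet (hα : α ∈ badSet M κ) :
    (M : ℝ) ^ 6 / 4 ≤
      (∑ x ∈ tripleBox M, scaleDifference κ (1 / M) (α.2 - zeroLine x α.1)) ^ 2 := by
  have hcoarse := le_sum_uniformDensity_zeroLine M hα.1.1 hα.1.2
  have hfine : ∑ x ∈ tripleBox M, scaleDifference κ (1 / M) (α.2 - zeroLine x α.1) =
      -∑ x ∈ tripleBox M, uniformDensity (1 / M) (α.2 - zeroLine x α.1) := by
    rw [← Finset.sum_neg_distrib]
    refine Finset.sum_congr rfl fun x hx => ?_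
    rw [scaleDifference, uniformDensity_of_lt_abs (hα.2 x hx), zero_sub]
  rw [hfine, neg_sq]
  calc (M : ℝ) ^ 6 / 4 = ((M : ℝ) ^ 3 / 2) ^ 2 := by ring
    _ ≤ _ := by gcongr

lemma volume_badSet_le (hM : 0 < M) (hκ : 0 < κ) (hκM : (M : ℝ) ^ 2 * κ ≤ 1) :
    volume (badSet M κ) ≤ ENNReal.ofReal (652800 / (κ * (M : ℝ) ^ 5) *
      ∑ p ∈ pairBox M, ∑ q ∈ pairBox M, detWeight p q) := by
  have hM' : (0 : ℝ) < M := mod_cast hM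
  have hκw : κ ≤ 1 / M := by
    have hM1 : (1 : ℝ) ≤ M := mod_cast hM
    rw [le_div_iff₀ hM']
    nlinarith
  have hstrip : volume (badSet M κ) ≤
      ((volume.restrict (Icc (1 / 2 : ℝ) 1)).prod volume) (badSet M κ) := by
    rw [← Measure.restrict_univ (μ := (volume : Measure ℝ)), Measure.prod_restrict,
      Measure.restrict_univ, ← Measure.volume_eq_prod]
    refine (measure_mono ?_).trans (Measure.le_restrict_apply _ _)
    exact fun α hα => ⟨hα, hα.1.1, mem_univ _⟩
  have hinterval (f : ℝ → ℝ) : ∫ t in Icc (1 / 2 : ℝ) 1, f t ≤ |∫ t in (1 / 2 : ℝ)..1, f t| := by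
    rw [integral_Icc_eq_integral_Ioc, intervalIntegral.integral_of_le (by norm_num)]
    exact le_abs_self _
  refine hstrip.trans ((measure_le_of_forall_le_sq_sum_translate
    (integrable_scaleDifference κ (1 / M)) (measurable_scaleDifference κ (1 / M))
    (abs_scaleDifference_le hκ hκw) _ (tripleBox M) measurable_zeroLine
    (by positivity) fun α hα => le_sq_sum_scaleDifference_of_mem_badSet hα).trans
    (ENNReal.ofReal_le_ofReal ?_))
  rw [div_le_iff₀ (by positivity)]
  refine ((Finset.sum_le_sum fun x _ => Finset.sum_le_sum fun y _ => hinterval _).trans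
    (sum_sum_abs_integral_le_sum_detWeight hκ hκM)).trans_eq ?_
  field_simp
  ring

lemma sum_detWeight_two_pow_le (k : ℕ) :
    ∑ p ∈ pairBox (2 ^ k), ∑ q ∈ pairBox (2 ^ k), detWeight p q ≤
      40 * ((2 : ℝ) ^ k) ^ 2 * ((k : ℝ) + 3) ^ 2 := by
  have hgcd : (harmonic (2 * 2 ^ k) : ℝ) ≤ k + 2 := by
    have hlog := harmonic_le_of_le_two_pow (pow_succ' 2 k).ge
    push_cast at hlog
    linarith
  have hdet : (harmonic (10 * (2 ^ k) ^ 2) : ℝ) ≤ 2 * k + 5 := by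
    have hle : 10 * (2 ^ k) ^ 2 ≤ 2 ^ (2 * k + 4) := by
      rw [pow_add, pow_mul']
      omega
    have hlog := harmonic_le_of_le_two_pow hle
    push_cast at hlog
    linarith
  have hdet0 := harmonic_nonneg (10 * (2 ^ k) ^ 2)
  calc _ ≤ 10 * ((2 ^ k : ℕ) : ℝ) ^ 2 * harmonic (2 * 2 ^ k) *
        (1 + 2 * harmonic (10 * (2 ^ k) ^ 2)) := sum_detWeight_le (2 ^ k)
    _ ≤ 10 * ((2 ^ k : ℕ) : ℝ) ^ 2 * (k + 2) * (1 + 2 * (2 * k + 5)) := by gcongr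
    _ = 10 * ((2 : ℝ) ^ k) ^ 2 * ((k + 2) * (1 + 2 * (2 * k + 5))) := by
        push_cast
        ring
    _ ≤ 10 * ((2 : ℝ) ^ k) ^ 2 * (4 * ((k : ℝ) + 3) ^ 2) := by
        refine mul_le_mul_of_nonneg_left ?_ (by positivity)
        nlinarith [(Nat.cast_nonneg k : (0 : ℝ) ≤ k)]
    _ = _ := by ring

lemma rpow_neg_three_add_mul_pow {r : ℝ} (hr : 0 < r) (ε : ℝ) (n : ℕ) :
    r ^ (-3 + ε) * r ^ n = r ^ ((n : ℝ) - 3 + ε) := by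
  rw [← Real.rpow_natCast r n, ← Real.rpow_add hr]
  ring_nf

lemma volume_badSet_two_pow_le (hε : ε ≤ 1) (k : ℕ) :
    volume (badSet (2 ^ k) (((2 : ℝ) ^ k) ^ (-3 + ε))) ≤
      ENNReal.ofReal (26112000 * (((k : ℝ) + 3) ^ 2 * ((2 : ℝ) ^ (-ε)) ^ k)) := by
  have hr : (0 : ℝ) < 2 ^ k := by positivity
  have hκ : 0 < ((2 : ℝ) ^ k) ^ (-3 + ε) := Real.rpow_pos_of_pos hr _
  have hκM : ((2 ^ k : ℕ) : ℝ) ^ 2 * ((2 : ℝ) ^ k) ^ (-3 + ε) ≤ 1 := by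
    push_cast
    rw [mul_comm, rpow_neg_three_add_mul_pow hr]
    exact Real.rpow_le_one_of_one_le_of_nonpos (one_le_pow₀ one_le_two) (by push_cast; linarith)
  refine (volume_badSet_le (by positivity) hκ hκM).trans (ENNReal.ofReal_le_ofReal ?_)
  push_cast
  calc 652800 / (((2 : ℝ) ^ k) ^ (-3 + ε) * ((2 : ℝ) ^ k) ^ 5) *
        ∑ p ∈ pairBox (2 ^ k), ∑ q ∈ pairBox (2 ^ k), detWeight p q
      ≤ 652800 / (((2 : ℝ) ^ k) ^ (-3 + ε) * ((2 : ℝ) ^ k) ^ 5) *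
        (40 * ((2 : ℝ) ^ k) ^ 2 * ((k : ℝ) + 3) ^ 2) := by
        gcongr
        exact sum_detWeight_two_pow_le k
    _ = 26112000 * (((k : ℝ) + 3) ^ 2 * (((2 : ℝ) ^ k) ^ (-3 + ε) * ((2 : ℝ) ^ k) ^ 3)⁻¹) := by
        field_simp
        ring
    _ = 26112000 * (((k : ℝ) + 3) ^ 2 * ((2 : ℝ) ^ (-ε)) ^ k) := by
        rw [rpow_neg_three_add_mul_pow hr, Real.rpow_pow_comm zero_le_two,
          Real.rpow_neg hr.le, Nat.cast_ofNat, sub_self, zero_add]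

lemma summable_add_three_sq_mul_geometric {r : ℝ} (hr : ‖r‖ < 1) :
    Summable fun k : ℕ => ((k : ℝ) + 3) ^ 2 * r ^ k := by
  have hpow (n : ℕ) := summable_pow_mul_geometric_of_norm_lt_one n hr
  refine (((hpow 2).add ((hpow 1).mul_left 6)).add ((hpow 0).mul_left 9)).congr fun k => ?_
  ring

lemma ae_eventually_notMem_badSet (hε : 0 < ε) (hε1 : ε ≤ 1) :
    ∀ᵐ α : ℝ × ℝ, ∀ᶠ k : ℕ in Filter.atTop, α ∉ badSet (2 ^ k) (((2 : ℝ) ^ k) ^ (-3 + ε)) := by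
  have hratio : ‖(2 : ℝ) ^ (-ε)‖ < 1 := by
    rw [Real.norm_of_nonneg (by positivity)]
    exact Real.rpow_lt_one_of_one_lt_of_neg one_lt_two (neg_neg_of_pos hε)
  exact ae_eventually_notMem (ne_top_of_le_ne_top
    ((summable_add_three_sq_mul_geometric hratio).mul_left _).tsum_ofReal_ne_top
    (ENNReal.tsum_le_tsum (volume_badSet_two_pow_le hε1)))

end BadSet

section Minimum

variable {M k : ℕ} {κ ε N m : ℝ} {α : ℝ × ℝ}

lemma euclNorm_sq (x : Fin 3 → ℤ) :
    euclNorm x ^ 2 = (x 0 : ℝ) ^ 2 + (x 1 : ℝ) ^ 2 + (x 2 : ℝ) ^ 2 := by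
  rw [euclNorm, EuclideanSpace.norm_sq_eq, Fin.sum_univ_three]
  simp only [Real.norm_eq_abs, sq_abs]

lemma abs_diagForm_mem_absValues {x : Fin 3 → ℤ} (α₂ α₃ : ℝ) (hN : 0 ≤ N)
    (h0 : 0 < (x 0 : ℝ) ^ 2 + (x 1 : ℝ) ^ 2 + (x 2 : ℝ) ^ 2)
    (hlt : (x 0 : ℝ) ^ 2 + (x 1 : ℝ) ^ 2 + (x 2 : ℝ) ^ 2 < N ^ 2) :
    |diagForm α₂ α₃ x| ∈ absValues α₂ α₃ N := by
  rw [← euclNorm_sq] at h0 hlt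
  exact ⟨x, (norm_nonneg _).lt_of_ne' (pow_ne_zero_iff two_ne_zero |>.mp h0.ne'),
    lt_of_pow_lt_pow_left₀ 2 hN hlt, rfl⟩

lemma one_mem_absValues (α₂ α₃ : ℝ) (hN : 1 < N) : 1 ∈ absValues α₂ α₃ N := by
  simpa [diagForm] using abs_diagForm_mem_absValues (x := ![1, 0, 0]) α₂ α₃ (N := N)
    (by linarith) (by simp) (by simpa using hN.trans_le (le_abs_self N))

lemma finite_absValues (α₂ α₃ N : ℝ) : (absValues α₂ α₃ N).Finite := by
  refine ((Set.finite_Icc (fun _ : Fin 3 => -⌈N⌉) (fun _ => ⌈N⌉)).image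
    fun x => |diagForm α₂ α₃ x|).subset ?_
  rintro v ⟨x, -, hx, rfl⟩
  have hcoord (i : Fin 3) : |x i| ≤ ⌈N⌉ := by
    have hnorm : ‖(x i : ℝ)‖ ≤ euclNorm x :=
      PiLp.norm_apply_le (WithLp.toLp 2 (fun i => (x i : ℝ)) : EuclideanSpace ℝ (Fin 3)) i
    rw [Real.norm_eq_abs] at hnorm
    exact_mod_cast hnorm.trans (hx.le.trans (Int.le_ceil N))
  exact ⟨x, ⟨fun i => (abs_le.mp (hcoord i)).1, fun i => (abs_le.mp (hcoord i)).2⟩, rfl⟩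

lemma exists_isLeast_absValues (α₂ α₃ : ℝ) (hN : 1 < N) :
    ∃ m, IsLeast (absValues α₂ α₃ N) m := by
  obtain ⟨m, hm, hle⟩ := exists_min_image _ id (finite_absValues α₂ α₃ N)
    ⟨1, one_mem_absValues α₂ α₃ hN⟩
  exact ⟨m, hm, hle⟩

lemma exists_mem_absValues_le (hα : α ∈ Icc (1 / 2 : ℝ) 1 ×ˢ Icc (1 / 2 : ℝ) 1)
    (hbad : α ∉ badSet M κ) (hN : 8 * (M : ℝ) ≤ N) :
    ∃ v ∈ absValues α.1 α.2 N, v ≤ 25 * (M : ℝ) ^ 2 * κ := by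
  obtain ⟨⟨a, p⟩, hx, hle⟩ : ∃ x ∈ tripleBox M, |α.2 - zeroLine x α.1| ≤ κ := by
    by_contra! hcon
    exact hbad ⟨hα, hcon⟩
  obtain ⟨ha, hp⟩ := Finset.mem_product.mp hx
  have ha' : (a : ℝ) ≤ 5 * M := mod_cast (Finset.mem_Icc.mp ha).2
  have hM := pos_of_mem_pairBox hp
  obtain ⟨-, hb⟩ := fst_bounds_of_mem_pairBox hp
  obtain ⟨hc, hc'⟩ := snd_bounds_of_mem_pairBox hp
  have hc0 : (0 : ℝ) < p.2 := by linarith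
  have hnorm : (a : ℝ) ^ 2 + (p.1 : ℝ) ^ 2 + (p.2 : ℝ) ^ 2 < N ^ 2 :=
    calc _ ≤ (5 * (M : ℝ)) ^ 2 + (2 * M) ^ 2 + (5 * M) ^ 2 := by gcongr
      _ < (8 * (M : ℝ)) ^ 2 := by nlinarith
      _ ≤ N ^ 2 := by gcongr
  refine ⟨_, abs_diagForm_mem_absValues (x := ![(a : ℤ), p.1, p.2]) α.1 α.2 (by linarith)
    (add_pos_of_nonneg_of_pos (by positivity) (by simpa using pow_pos hc0 2)) hnorm, ?_⟩
  have hform : diagForm α.1 α.2 ![(a : ℤ), p.1, p.2] =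
      -((p.2 : ℝ) ^ 2 * (α.2 - zeroLine (a, p) α.1)) := by
    simp only [diagForm, zeroLine, zeroSlope, Matrix.cons_val_zero, Matrix.cons_val_one,
      Matrix.cons_val, Int.cast_natCast]
    field_simp
    ring
  rw [hform, abs_neg, abs_mul, abs_of_nonneg (sq_nonneg (p.2 : ℝ))]
  calc _ ≤ (5 * (M : ℝ)) ^ 2 * κ := by gcongr
    _ = 25 * (M : ℝ) ^ 2 * κ := by ring

lemma isLeast_absValues_le_of_notMem_badSet (hε : 0 ≤ ε) (hε1 : ε ≤ 1)
    (hα : α ∈ Icc (1 / 2 : ℝ) 1 ×ˢ Icc (1 / 2 : ℝ) 1)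
    (hbad : α ∉ badSet (2 ^ k) (((2 : ℝ) ^ k) ^ (-3 + ε))) (hN : 8 * 2 ^ k ≤ N)
    (hN' : N < 16 * 2 ^ k) (hm : IsLeast (absValues α.1 α.2 N) m) :
    m ≤ 400 * N ^ (-1 + ε) := by
  have hr : (0 : ℝ) < 2 ^ k := by positivity
  obtain ⟨v, hv, hle⟩ := exists_mem_absValues_le hα hbad (by push_cast; exact hN)
  calc m ≤ v := hm.2 hv
    _ ≤ 25 * (((2 : ℝ) ^ k) ^ (-3 + ε) * ((2 : ℝ) ^ k) ^ 2) := by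
        push_cast at hle
        linarith
    _ = 25 * ((2 : ℝ) ^ k) ^ (-1 + ε) := by
        rw [rpow_neg_three_add_mul_pow hr]
        norm_num
    _ ≤ 25 * (N / 16) ^ (-1 + ε) := by
        gcongr 25 * ?_
        exact Real.rpow_le_rpow_of_nonpos (by linarith) (by linarith) (by linarith)
    _ = 25 * (16 : ℝ) ^ (1 - ε) * N ^ (-1 + ε) := by
        rw [Real.div_rpow (by linarith) (by norm_num), div_eq_mul_inv,
          ← Real.rpow_neg (by norm_num), neg_add, neg_neg, ← sub_eq_add_neg]
        ring
    _ ≤ 25 * (16 : ℝ) ^ (1 : ℝ) * N ^ (-1 + ε) := by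
        have hNpos : 0 < N := by linarith
        gcongr <;> linarith
    _ = 400 * N ^ (-1 + ε) := by norm_num

lemma exists_forall_isLeast_le_of_eventually_notMem_badSet (hε : 0 ≤ ε) (hε1 : ε ≤ 1)
    (hα : α ∈ Icc (1 / 2 : ℝ) 1 ×ˢ Icc (1 / 2 : ℝ) 1)
    (h : ∀ᶠ k : ℕ in Filter.atTop, α ∉ badSet (2 ^ k) (((2 : ℝ) ^ k) ^ (-3 + ε))) :
    ∃ C : ℝ, 0 < C ∧ ∀ N : ℝ, 1 < N → ∃ m : ℝ, IsLeast (absValues α.1 α.2 N) m ∧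
      m ≤ C * N ^ (-1 + ε) := by
  obtain ⟨k₀, hk₀⟩ := Filter.eventually_atTop.mp h
  have hpow : (1 : ℝ) ≤ 2 ^ k₀ := one_le_pow₀ one_le_two
  refine ⟨400 * 2 ^ k₀, by positivity, fun N hN => ?_⟩
  have hN0 : 0 < N := by linarith
  obtain ⟨m, hm⟩ := exists_isLeast_absValues α.1 α.2 hN
  refine ⟨m, hm, ?_⟩
  rcases lt_or_ge N (8 * 2 ^ k₀) with hsmall | hlarge
  · calc m ≤ 1 := hm.2 (one_mem_absValues α.1 α.2 hN)
      _ ≤ 400 * 2 ^ k₀ * N ^ (-1 : ℝ) := by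
          rw [Real.rpow_neg_one, ← div_eq_mul_inv, le_div_iff₀ hN0]
          linarith
      _ ≤ 400 * 2 ^ k₀ * N ^ (-1 + ε) := by gcongr <;> linarith
  · obtain ⟨k, hk, hk'⟩ := exists_nat_pow_near (x := N / 8) (y := 2) (by linarith) one_lt_two
    have hk₀k : k₀ ≤ k := by
      have hlt : (2 : ℝ) ^ k₀ < 2 ^ (k + 1) := by linarith
      exact Nat.lt_succ_iff.mp ((pow_lt_pow_iff_right₀ one_lt_two).mp hlt)
    calc m ≤ 400 * N ^ (-1 + ε) := isLeast_absValues_le_of_notMem_badSet hε hε1 hα (hk₀ k hk₀k)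
          (by linarith) (by rw [pow_succ] at hk'; linarith) hm
      _ ≤ 400 * 2 ^ k₀ * N ^ (-1 + ε) := by
          gcongr
          linarith

end Minimum

theorem mainTheorem3 :
    ∀ᵐ α : ℝ × ℝ ∂((volume : Measure (ℝ × ℝ)).restrict
        (Icc (1 / 2 : ℝ) 1 ×ˢ Icc (1 / 2 : ℝ) 1)),
      ∀ ε : ℝ, 0 < ε → ∃ C : ℝ, 0 < C ∧ ∀ N : ℝ, 1 < N →
        ∃ m : ℝ, IsLeast (absValues α.1 α.2 N) m ∧ m ≤ C * N ^ (-1 + ε) := by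
  have hpos (n : ℕ) : 0 < 1 / ((n : ℝ) + 1) := Nat.one_div_pos_of_nat
  have hle_one (n : ℕ) : 1 / ((n : ℝ) + 1) ≤ 1 := by
    rw [div_le_one (by positivity)]
    linarith [(Nat.cast_nonneg n : (0 : ℝ) ≤ n)]
  have hbad : ∀ᵐ α : ℝ × ℝ, ∀ n : ℕ, ∀ᶠ k : ℕ in Filter.atTop,
      α ∉ badSet (2 ^ k) (((2 : ℝ) ^ k) ^ (-3 + 1 / ((n : ℝ) + 1))) :=
    ae_all_iff.mpr fun n => ae_eventually_notMem_badSet (hpos n) (hle_one n)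
  filter_upwards [ae_restrict_of_ae hbad,
    ae_restrict_mem (measurableSet_Icc.prod measurableSet_Icc)] with α hα hsquare ε hε
  obtain ⟨n, hn⟩ := exists_nat_one_div_lt hε
  obtain ⟨C, hC, hbound⟩ := exists_forall_isLeast_le_of_eventually_notMem_badSet
    (hpos n).le (hle_one n) hsquare (hα n)
  refine ⟨C, hC, fun N hN => ?_⟩
  obtain ⟨m, hm, hmN⟩ := hbound N hN
  refine ⟨m, hm, hmN.trans ?_⟩
  gcongr
  exact hN.le
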